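/- Let $\{n_k\}_{k\ge 1}$ be a sequence of integers $n_k\ge 2$, and let $K$ be a field that contains a primitive $n_k$-th root of unity for every $k\ge 1$. For $k\ge 1$ let $f_k=a_kx^{n_k}+b_k\in K[x]$ with $a_k\neq 0$, put $\mathcal F=\{f_k\}_{k\ge 1}$, and let $\alpha\in K$. Write $f^{(0)}=x$ and $f^{(m)}=f_1\circ\cdots\circ f_m$ for $m\ge 1$. Let $c_{1,\alpha}=\alpha-f_1(0)$ if $n_1=2$, and $c_{m,\alpha}=f^{(m)}(0)-\alpha$ in all other cases with $m\ge 1$. Let $N_m=n_1\cdots n_m$ (with $N_0=1$) and, for $m\ge 1$, $$\widetilde c_{m,\alpha}=(-1)^{N_{m-1}}\,\frac{f^{(m)}(0)-\alpha}{\prod_{i=1}^{m}a_i^{N_{i-1}}},$$ where the denominator is the leading coefficient of $f^{(m)}$. Suppose that $c_{m,\alpha}\neq 0$ for every $m\ge 1$ (equivalently, all the polynomials $f^{(m)}-\alpha$ are separable). Let $d_1$ be the degree over $K$ of the field generated by the roots of $f_1-\alpha$ in a separable closure $K^{\mathrm{sep}}$. Let $G_\infty(\mathcal F,\alpha)$ be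 the Galois group over $K$ of the subfield of $K^{\mathrm{sep}}$ generated over $K$ by all roots of all $f^{(m)}-\alpha$, $m\ge 0$, and suppose that $G_\infty(\mathcal F,\alpha)$ is abelian. Then $d_1$ divides $n_1$, there is an element $\gamma_1\in K^\times$ with $\gamma_1^{n_1/d_1}=\widetilde c_{1,\alpha}$, and for every such $\gamma_1$ the subgroup of $K^\times/K^{\times d_1}$ spanned by the classes of $$\widetilde c_{k,\alpha}^{\;d_1/\gcd(d_1,n_k)},\qquad k\ge 2,$$ is contained in the cyclic subgroup generated by the class of $\gamma_1$. -/

import Mathlib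

open Polynomial

namespace ArborealSeq

noncomputable section

variable {K : Type*} [Field K]

/-- The polynomial `f_k = a_k x^{n_k} + b_k`. Sequences are indexed from `1`; the entries of
`n`, `a`, `b` at index `0` play no role. -/
def poly (n : ℕ → ℕ) (a b : ℕ → K) (k : ℕ) : K[X] :=
  C (a k) * X ^ n k + C (b k)

/-- The composition `f^{(m)} = f_1 ∘ ⋯ ∘ f_m`, with `f^{(0)} = x`. -/
def iter (n : ℕ → ℕ) (a b : ℕ → K) : ℕ → K[X]
  | 0 => X
  | m + 1 => (iter n a b m).comp (poly n a b (m + 1))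

/-- The adjusted post-critical orbit `c_{m,α}` of the sequence `(f_k)` and the point `α`. -/
def adjOrbit (n : ℕ → ℕ) (a b : ℕ → K) (α : K) (m : ℕ) : K :=
  if n 1 = 2 ∧ m = 1 then -(poly n a b 1).eval 0 + α
  else (iter n a b m).eval 0 - α

/-- The number `#L_m = n_1 ⋯ n_m` of nodes at level `m` of the tree. -/
def levelCard (n : ℕ → ℕ) (m : ℕ) : ℕ :=
  ∏ i ∈ Finset.Icc 1 m, n i

/-- The element `c̃_{m,α} = (-1)^{#L_{m-1}} (f^{(m)}(0) - α) / ∏_{i=1}^m a_i^{#L_{i-1}}`, used for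
`m ≥ 1`. The denominator is the leading coefficient of `f^{(m)}`. -/
def cTilde (n : ℕ → ℕ) (a b : ℕ → K) (α : K) (m : ℕ) : K :=
  (-1) ^ levelCard n (m - 1) *
    (((iter n a b m).eval 0 - α) / ∏ i ∈ Finset.Icc 1 m, a i ^ levelCard n (i - 1))

theorem cTilde_ne_zero {n : ℕ → ℕ} {a b : ℕ → K} {α : K} (ha : ∀ k, 1 ≤ k → a k ≠ 0)
    (hc : ∀ m, 1 ≤ m → adjOrbit n a b α m ≠ 0) (m : ℕ) (hm : 1 ≤ m) :
    cTilde n a b α m ≠ 0 := by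
  have h1 : (iter n a b m).eval 0 - α ≠ 0 := by
    have h := hc m hm
    unfold adjOrbit at h
    split_ifs at h with h2
    · obtain ⟨-, rfl⟩ := h2
      intro h3
      apply h
      simp only [iter, X_comp] at h3
      rw [sub_eq_zero.mp h3, neg_add_cancel]
    · exact h
  unfold cTilde
  refine mul_ne_zero (pow_ne_zero _ (neg_ne_zero.mpr one_ne_zero)) (div_ne_zero h1 ?_)
  refine Finset.prod_ne_zero_iff.mpr fun i hi => pow_ne_zero _ (ha i ?_)
  exact (Finset.mem_Icc.mp hi).1

/-- `c̃_{m,α}` as an element of `Kˣ`, when `a_k ≠ 0` and `c_{k,α} ≠ 0` for all `k ≥ 1`. -/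
def cTildeUnit {n : ℕ → ℕ} {a b : ℕ → K} {α : K} (ha : ∀ k, 1 ≤ k → a k ≠ 0)
    (hc : ∀ m, 1 ≤ m → adjOrbit n a b α m ≠ 0) (m : ℕ) (hm : 1 ≤ m) : Kˣ :=
  Units.mk0 (cTilde n a b α m) (cTilde_ne_zero ha hc m hm)

/-- The extension of `K` generated by all roots of `f_1 - α` in the separable closure. -/
def firstField (n : ℕ → ℕ) (a b : ℕ → K) (α : K) : IntermediateField K (SeparableClosure K) :=
  IntermediateField.adjoin K ((poly n a b 1 - C α).rootSet (SeparableClosure K))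

/-- The arboreal field: the extension of `K` generated by all nodes of the tree, that is, by the
roots in the separable closure of all the polynomials `f^{(m)} - α`. -/
def arborealField (n : ℕ → ℕ) (a b : ℕ → K) (α : K) :
    IntermediateField K (SeparableClosure K) :=
  IntermediateField.adjoin K (⋃ m : ℕ, (iter n a b m - C α).rootSet (SeparableClosure K))

/-- The arboreal Galois group `G_∞`: the Galois group of the arboreal field over `K`. -/
abbrev arborealGroup (n : ℕ → ℕ) (a b : ℕ → K) (α : K) : Type _ :=
  arborealField n a b α ≃ₐ[K] arborealField n a b α

/-- The subgroup `K^{×d}` of `d`-th powers in `K^×`. -/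
abbrev powSubgroup (K : Type*) [Field K] (d : ℕ) : Subgroup Kˣ :=
  (powMonoidHom d : Kˣ →* Kˣ).range

end

end ArborealSeq

/-!
The roots of `f_1 - α` are the solutions of `x ^ n_1 = c̃_1`. Fix one of them, `β`. By Kummer theory
`K(β) / K` is cyclic of degree `d = d_1` and `γ = β ^ d` lies in `K`. The element `c̃_k` is the
product, over the roots `ζ ^ j • β` of `f_1 - α`, of the corresponding elements for `f_2 ∘ ⋯ ∘ f_k`,
and each factor has an `n_k`-th root `w j` in the arboreal field. Let `τ` restrict to a generator of
`Gal(K(β) / K)`. Since the arboreal group is abelian, an automorphism fixing `β` multiplies the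
`w j` in one orbit of `τ` by the same root of unity, and therefore fixes
`y = (∏ j, w j) ^ (n_k / gcd(d, n_k))`. Hence `y` lies in `K(β)`, while `y ^ d` lies in `K`, and
Kummer theory gives `y = u • β ^ i` with `u` in `Kˣ`. Taking `d`-th powers yields
`c̃_k ^ (d / gcd(d, n_k)) = γ ^ i * u ^ d`.
-/

namespace ArborealSeq

section Compositions

/-- The sequence with its first entry dropped, reindexed from `1`. Shifting `n`, `a`, `b` passes
from the family `f_1, f_2, …` to `f_2, f_3, …`. -/
def shift {A : Type*} (s : ℕ → A) : ℕ → A := fun i => s (i + 1)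

variable {F E : Type*} [Field F] [Field E] {n : ℕ → ℕ} {a b : ℕ → F}

theorem map_iter (φ : F →+* E) (n : ℕ → ℕ) (a b : ℕ → F) (m : ℕ) :
    (iter n a b m).map φ = iter n (φ ∘ a) (φ ∘ b) m := by
  induction m with
  | zero => simp [iter]
  | succ m ih => simp [iter, Polynomial.map_comp, ih, poly]

theorem iter_one (n : ℕ → ℕ) (a b : ℕ → F) : iter n a b 1 = poly n a b 1 := by
  simp only [iter, X_comp]

theorem iter_succ_eq_poly_comp (n : ℕ → ℕ) (a b : ℕ → F) (m : ℕ) :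
    iter n a b (m + 1) = (poly n a b 1).comp (iter (shift n) (shift a) (shift b) m) := by
  induction m with
  | zero => rw [iter_one, iter, comp_X]
  | succ m ih => rw [iter, ih, iter, comp_assoc]; rfl

theorem natDegree_iter (ha : ∀ k, 1 ≤ k → a k ≠ 0) (m : ℕ) :
    (iter n a b m).natDegree = levelCard n m := by
  induction m with
  | zero => simp [iter, levelCard]
  | succ m ih =>
    rw [iter, natDegree_comp, ih, levelCard, levelCard, Finset.prod_Icc_succ_top (by omega), poly,
      natDegree_add_C, natDegree_C_mul_X_pow _ _ (ha _ (by omega))]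

theorem iter_sub_C_ne_zero (hn : ∀ k, 1 ≤ k → n k ≠ 0) (ha : ∀ k, 1 ≤ k → a k ≠ 0) (α : F)
    (m : ℕ) : iter n a b m - C α ≠ 0 := by
  refine ne_zero_of_natDegree_gt (n := 0) (Nat.pos_of_ne_zero ?_)
  rw [natDegree_sub_C, natDegree_iter ha, levelCard]
  exact Finset.prod_ne_zero_iff.mpr fun k hk => hn k (Finset.mem_Icc.mp hk).1

theorem eval_poly (k : ℕ) (x : F) : (poly n a b k).eval x = a k * x ^ n k + b k := by
  simp [poly]

theorem eval_poly_pow_mul {k : ℕ} {ζ : F} (hζ : ζ ^ n k = 1) (j : ℕ) (x : F) :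
    (poly n a b k).eval (ζ ^ j * x) = (poly n a b k).eval x := by
  rw [eval_poly, eval_poly, mul_pow, pow_right_comm, hζ, one_pow, one_mul]

theorem prod_Icc_one_succ {M : Type*} [CommMonoid M] (f : ℕ → M) (m : ℕ) :
    ∏ i ∈ Finset.Icc 1 (m + 1), f i = f 1 * ∏ i ∈ Finset.Icc 1 m, f (i + 1) := by
  induction m with
  | zero => simp
  | succ m ih =>
    rw [Finset.prod_Icc_succ_top (by omega), ih, Finset.prod_Icc_succ_top (by omega), mul_assoc]

theorem levelCard_succ (n : ℕ → ℕ) (m : ℕ) :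
    levelCard n (m + 1) = n 1 * levelCard (shift n) m :=
  prod_Icc_one_succ n m

theorem prod_pow_levelCard_succ (n : ℕ → ℕ) (a : ℕ → F) (m : ℕ) :
    ∏ i ∈ Finset.Icc 1 (m + 1), a i ^ levelCard n (i - 1) =
      a 1 * (∏ i ∈ Finset.Icc 1 m, shift a i ^ levelCard (shift n) (i - 1)) ^ n 1 := by
  rw [prod_Icc_one_succ, ← Finset.prod_pow]
  congr 1
  · simp [levelCard]
  · refine Finset.prod_congr rfl fun i hi => ?_
    obtain ⟨j, rfl⟩ := Nat.exists_eq_add_of_le' (Finset.mem_Icc.mp hi).1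
    rw [Nat.add_sub_cancel, Nat.add_sub_cancel, levelCard_succ, mul_comm, pow_mul, shift]

theorem cTilde_one (a b : ℕ → F) (α : F) (hn : n 1 ≠ 0) :
    cTilde n a b α 1 = (α - b 1) / a 1 := by
  simp [cTilde, levelCard, iter, poly, hn, ← neg_div]

theorem pow_eq_cTilde_one_iff {α x : F} (hn : n 1 ≠ 0) (ha : a 1 ≠ 0) :
    x ^ n 1 = cTilde n a b α 1 ↔ (poly n a b 1).eval x = α := by
  rw [cTilde_one a b α hn, eq_div_iff ha, eval_poly, mul_comm, eq_sub_iff_add_eq]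

theorem map_cTilde (φ : F →+* E) (n : ℕ → ℕ) (a b : ℕ → F) (α : F) (m : ℕ) :
    φ (cTilde n a b α m) = cTilde n (φ ∘ a) (φ ∘ b) (φ α) m := by
  have hzero : φ ((iter n a b m).eval 0) = (iter n (φ ∘ a) (φ ∘ b) m).eval 0 := by
    rw [← map_iter, eval_map, ← eval₂_at_apply, map_zero]
  simp [cTilde, hzero]

/-- This is the factorisation of `y ^ n_1 - β ^ n_1` at `y = (f_2 ∘ ⋯ ∘ f_{m+2})(0)`. -/
theorem cTilde_succ_eq_prod (hn : n 1 ≠ 0) (ha : a 1 ≠ 0) {ζ : F} (hζ : IsPrimitiveRoot ζ (n 1))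
    (β : F) (m : ℕ) :
    cTilde n a b ((poly n a b 1).eval β) (m + 2) =
      ∏ j ∈ Finset.range (n 1), cTilde (shift n) (shift a) (shift b) (ζ ^ j * β) (m + 1) := by
  have hfactor (y : F) : y ^ n 1 - β ^ n 1 = ∏ j ∈ Finset.range (n 1), (y - ζ ^ j * β) := by
    have := congrArg (eval y) (X_pow_sub_C_eq_prod hζ (Nat.pos_of_ne_zero hn) (Eq.refl (β ^ n 1)))
    simpa [eval_prod] using this
  simp only [cTilde, Finset.prod_mul_distrib, Finset.prod_div_distrib, ← hfactor,
    Finset.prod_const, Finset.card_range, iter_succ_eq_poly_comp n a b (m + 1), eval_comp,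
    eval_poly, prod_pow_levelCard_succ n a (m + 1), Nat.add_sub_cancel]
  rw [show m + 2 - 1 = m + 1 from rfl, levelCard_succ, add_sub_add_right_eq_sub, ← mul_sub,
    mul_div_mul_left _ _ ha, ← pow_mul, mul_comm (n 1)]

theorem exists_eval_poly_eq [IsSepClosed F] {k : ℕ} (hn : (n k : F) ≠ 0) (ha : a k ≠ 0) (α : F) :
    ∃ β, (poly n a b k).eval β = α := by
  have : NeZero (n k : F) := ⟨hn⟩
  obtain ⟨β, hβ⟩ := IsSepClosed.exists_pow_nat_eq ((α - b k) / a k) (n k)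
  exact ⟨β, by rw [eval_poly, hβ, mul_div_cancel₀ _ ha, sub_add_cancel]⟩

theorem exists_pow_eq_cTilde [IsSepClosed F] (hn : ∀ k, 1 ≤ k → (n k : F) ≠ 0)
    (ha : ∀ k, 1 ≤ k → a k ≠ 0) {α : F} {m : ℕ} {S : Submonoid F}
    (hS : ∀ z, (iter n a b (m + 1)).eval z = α → z ∈ S) :
    ∃ w ∈ S, w ^ n (m + 1) = cTilde n a b α (m + 1) := by
  induction m generalizing n a b α with
  | zero =>
    have hn₁ : n 1 ≠ 0 := fun h => hn 1 le_rfl (by simp [h])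
    obtain ⟨β, hβ⟩ := exists_eval_poly_eq (b := b) (hn 1 le_rfl) (ha 1 le_rfl) α
    exact ⟨β, hS β (by rwa [iter_one]), (pow_eq_cTilde_one_iff hn₁ (ha 1 le_rfl)).mpr hβ⟩
  | succ m ih =>
    have hn₁ : n 1 ≠ 0 := fun h => hn 1 le_rfl (by simp [h])
    have : NeZero (n 1 : F) := ⟨hn 1 le_rfl⟩
    obtain ⟨β, rfl⟩ := exists_eval_poly_eq (b := b) (hn 1 le_rfl) (ha 1 le_rfl) α
    obtain ⟨ζ, hζ⟩ := HasEnoughRootsOfUnity.exists_primitiveRoot F (n 1)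
    have hfactor (j : ℕ) : ∃ w ∈ S, w ^ n (m + 2) =
        cTilde (shift n) (shift a) (shift b) (ζ ^ j * β) (m + 1) := by
      refine ih (n := shift n) (a := shift a) (fun k _ => hn _ (by omega))
        (fun k _ => ha _ (by omega)) fun z hz => hS z ?_
      rw [iter_succ_eq_poly_comp, eval_comp, hz, eval_poly_pow_mul hζ.pow_eq_one]
    choose w hwS hw using hfactor
    refine ⟨∏ j ∈ Finset.range (n 1), w j, S.prod_mem fun j _ => hwS j, ?_⟩
    rw [← Finset.prod_pow, cTilde_succ_eq_prod hn₁ (ha 1 le_rfl) hζ]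
    exact Finset.prod_congr rfl fun j _ => hw j

end Compositions

section Kummer

variable {K Ω : Type*} [Field K] [Field Ω] [Algebra K Ω]

theorem exists_eq_pow_smul_of_pow_eq {n : ℕ} [NeZero n] {ζ : K} (hζ : IsPrimitiveRoot ζ n)
    {x y : Ω} (hy : y ≠ 0) (h : x ^ n = y ^ n) : ∃ i : ℕ, x = ζ ^ i • y := by
  have hζ' := hζ.map_of_injective (algebraMap K Ω).injective
  obtain ⟨i, -, hi⟩ := hζ'.eq_pow_of_pow_eq_one
    (show (x / y) ^ n = 1 by rw [div_pow, h, div_self (pow_ne_zero _ hy)])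
  exact ⟨i, by rw [Algebra.smul_def, map_pow, hi, div_mul_cancel₀ _ hy]⟩

theorem exists_apply_eq_pow_smul {n : ℕ} [NeZero n] {ζ : K} (hζ : IsPrimitiveRoot ζ n)
    {x : Ω} (hx : x ≠ 0) {σ : Gal(Ω/K)} (hσ : σ (x ^ n) = x ^ n) : ∃ i : ℕ, σ x = ζ ^ i • x :=
  exists_eq_pow_smul_of_pow_eq hζ hx (by rwa [← map_pow])

theorem pow_apply_of_apply_eq_smul {σ : Gal(Ω/K)} {x : Ω} {c : K} (h : σ x = c • x) (i : ℕ) :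
    (σ ^ i) x = c ^ i • x := by
  induction i with
  | zero => simp
  | succ i ih => rw [pow_succ, AlgEquiv.mul_apply, h, map_smul, ih, smul_smul, pow_succ']

theorem ne_zero_of_pow_eq_algebraMap {n : ℕ} [NeZero n] {x : Ω} {c : Kˣ}
    (h : x ^ n = algebraMap K Ω c) : x ≠ 0 := by
  rintro rfl
  rw [zero_pow (NeZero.ne n), eq_comm, map_eq_zero] at h
  exact c.ne_zero h

theorem splits_minpoly_of_pow_mem_bot {n : ℕ} [NeZero n] {ζ : K} (hζ : IsPrimitiveRoot ζ n)
    {β : Ω} (hβn : β ^ n ∈ (⊥ : IntermediateField K Ω)) :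
    ((minpoly K β).map (algebraMap K Ω)).Splits := by
  obtain ⟨c, hc⟩ := IntermediateField.mem_bot.mp hβn
  have hdvd : minpoly K β ∣ X ^ n - C c := minpoly.dvd _ _ (by simp [hc])
  refine (X_pow_sub_C_splits_of_isPrimitiveRoot
    (hζ.map_of_injective (algebraMap K Ω).injective) hc.symm).of_dvd
    (monic_X_pow_sub_C _ (NeZero.ne n)).ne_zero ?_
  simpa using Polynomial.map_dvd (algebraMap K Ω) hdvd

theorem isIntegral_of_pow_mem_bot {n : ℕ} [NeZero n] {β : Ω}
    (hβn : β ^ n ∈ (⊥ : IntermediateField K Ω)) : IsIntegral K β := by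
  obtain ⟨c, hc⟩ := IntermediateField.mem_bot.mp hβn
  exact .of_pow (NeZero.pos n) (hc ▸ isIntegral_algebraMap)

theorem prod_roots_minpoly_mem_bot {β : Ω} (hβ : IsIntegral K β)
    (hsplit : ((minpoly K β).map (algebraMap K Ω)).Splits) :
    ((minpoly K β).map (algebraMap K Ω)).roots.prod ∈ (⊥ : IntermediateField K Ω) := by
  have hcoeff := hsplit.coeff_zero_eq_prod_roots_of_monic ((minpoly.monic hβ).map _)
  have hprod : ((minpoly K β).map (algebraMap K Ω)).roots.prod =
      (-1) ^ ((minpoly K β).map (algebraMap K Ω)).natDegree *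
        algebraMap K Ω ((minpoly K β).coeff 0) := by
    rw [← coeff_map, hcoeff, ← mul_assoc, ← mul_pow, neg_one_mul, neg_neg, one_pow, one_mul]
  rw [hprod]
  exact mul_mem (pow_mem (neg_mem (one_mem _)) _) (IntermediateField.algebraMap_mem _ _)

theorem pow_natDegree_minpoly_mem_bot {n : ℕ} [NeZero n] {ζ : K} (hζ : IsPrimitiveRoot ζ n)
    {β : Ω} (hβ : β ≠ 0) (hβn : β ^ n ∈ (⊥ : IntermediateField K Ω)) :
    β ^ (minpoly K β).natDegree ∈ (⊥ : IntermediateField K Ω) := by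
  have hsplit := splits_minpoly_of_pow_mem_bot hζ hβn
  have hint := isIntegral_of_pow_mem_bot hβn
  have hne : ((minpoly K β).map (algebraMap K Ω)).roots.prod ≠ 0 := by
    simpa [minpoly.ne_zero hint, ← coeff_zero_eq_aeval_zero'] using
      minpoly.coeff_zero_ne_zero hint hβ
  have hquot : (((minpoly K β).map (algebraMap K Ω)).roots.map (· / β)).prod ∈
      (⊥ : IntermediateField K Ω) := by
    refine multiset_prod_mem _ fun _ hx => ?_
    obtain ⟨r, hr, rfl⟩ := Multiset.mem_map.mp hx
    obtain ⟨c, hc⟩ := IntermediateField.mem_bot.mp hβn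
    have hrn : r ^ n = β ^ n := by
      have := aeval_eq_zero_of_dvd_aeval_eq_zero
        (minpoly.dvd K β (p := X ^ n - C c) (by simp [hc])) (by simpa using isRoot_of_mem_roots hr)
      simpa [sub_eq_zero, hc] using this
    obtain ⟨i, rfl⟩ := exists_eq_pow_smul_of_pow_eq hζ hβ hrn
    rw [smul_div_assoc, div_self hβ, ← Algebra.algebraMap_eq_smul_one]
    exact IntermediateField.algebraMap_mem _ _
  have := div_mem (prod_roots_minpoly_mem_bot hint hsplit) hquot
  rwa [Multiset.prod_map_div, Multiset.map_id', Multiset.map_const', Multiset.prod_replicate,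
    ← hsplit.natDegree_eq_card_roots, natDegree_map, div_div_cancel₀ hne] at this

theorem natDegree_minpoly_le_of_pow_mem_bot {β : Ω} {r : ℕ} (hr : 0 < r)
    (h : β ^ r ∈ (⊥ : IntermediateField K Ω)) : (minpoly K β).natDegree ≤ r := by
  obtain ⟨c, hc⟩ := IntermediateField.mem_bot.mp h
  rw [← natDegree_X_pow_sub_C (n := r) (r := c)]
  exact natDegree_le_natDegree
    (minpoly.min K β (monic_X_pow_sub_C c hr.ne') (by simp [hc]))

theorem natDegree_minpoly_dvd {β : Ω} (hβ : β ≠ 0) (hint : IsIntegral K β)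
    (hd : β ^ (minpoly K β).natDegree ∈ (⊥ : IntermediateField K Ω)) {n : ℕ}
    (hn : β ^ n ∈ (⊥ : IntermediateField K Ω)) : (minpoly K β).natDegree ∣ n := by
  set d := (minpoly K β).natDegree
  have hmod : β ^ (n % d) ∈ (⊥ : IntermediateField K Ω) := by
    have hβd : (β ^ d) ^ (n / d) ≠ 0 := pow_ne_zero _ (pow_ne_zero _ hβ)
    rw [← mul_div_cancel_left₀ (β ^ (n % d)) hβd, ← pow_mul, ← pow_add, Nat.div_add_mod, pow_mul]
    exact div_mem hn (pow_mem hd _)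
  refine Nat.dvd_of_mod_eq_zero (Nat.eq_zero_of_not_pos fun hpos => ?_)
  exact (Nat.mod_lt n (minpoly.natDegree_pos hint)).not_ge
    (natDegree_minpoly_le_of_pow_mem_bot hpos hmod)

theorem exists_pow_eq_of_isPrimitiveRoot [IsSepClosed Ω] {n : ℕ} [NeZero n] {ζ : K}
    (hζ : IsPrimitiveRoot ζ n) (x : Ω) : ∃ y : Ω, y ^ n = x := by
  have := (hζ.map_of_injective (algebraMap K Ω).injective).neZero'
  exact IsSepClosed.exists_pow_nat_eq x n

theorem exists_units_pow_div_natDegree_minpoly_eq {n : ℕ} [NeZero n] {ζ : K}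
    (hζ : IsPrimitiveRoot ζ n) {β : Ω} {c : Kˣ} (hβ : β ^ n = algebraMap K Ω c) :
    (minpoly K β).natDegree ∣ n ∧ ∃ γ : Kˣ, γ ^ (n / (minpoly K β).natDegree) = c := by
  have hβn : β ^ n ∈ (⊥ : IntermediateField K Ω) := IntermediateField.mem_bot.mpr ⟨c, hβ.symm⟩
  have hβ₀ : β ≠ 0 := ne_zero_of_pow_eq_algebraMap hβ
  have hd := pow_natDegree_minpoly_mem_bot hζ hβ₀ hβn
  have hdvd := natDegree_minpoly_dvd hβ₀ (isIntegral_of_pow_mem_bot hβn) hd hβn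
  obtain ⟨γ, hγ⟩ := IntermediateField.mem_bot.mp hd
  have hpow : γ ^ (n / (minpoly K β).natDegree) = c := (algebraMap K Ω).injective <| by
    rw [map_pow, hγ, ← pow_mul, Nat.mul_div_cancel' hdvd, hβ]
  have hquot : n / (minpoly K β).natDegree ≠ 0 := (Nat.div_pos (Nat.le_of_dvd (NeZero.pos n) hdvd)
    (minpoly.natDegree_pos (isIntegral_of_pow_mem_bot hβn))).ne'
  have hγ₀ : γ ≠ 0 := by
    rintro rfl
    exact c.ne_zero (by rw [← hpow, zero_pow hquot])
  exact ⟨hdvd, Units.mk0 γ hγ₀, Units.ext hpow⟩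

theorem exists_algEquiv_apply_eq_smul [Normal K Ω] {β : Ω}
    (hβ : β ^ (minpoly K β).natDegree ∈ (⊥ : IntermediateField K Ω)) {η : K}
    (hη : η ^ (minpoly K β).natDegree = 1) : ∃ τ : Gal(Ω/K), τ β = η • β := by
  obtain ⟨γ, hγ⟩ := IntermediateField.mem_bot.mp hβ
  have hint : IsIntegral K β := Normal.isIntegral inferInstance β
  have hmin : X ^ (minpoly K β).natDegree - C γ = minpoly K β :=
    eq_of_monic_of_dvd_of_natDegree_le (minpoly.monic hint)
      (monic_X_pow_sub_C γ (minpoly.natDegree_pos hint).ne') (minpoly.dvd _ _ (by simp [hγ]))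
      natDegree_X_pow_sub_C.le
  refine (isConjRoot_of_aeval_eq_zero hint ?_).symm.exists_algEquiv
  rw [← hmin]
  simp [_root_.smul_pow, hη, hγ]

/-- An automorphism scaling `β` by a generator of the `d`-th roots of unity scales `y` and some
`β ^ e` by the same factor, so `y / β ^ e` is fixed. -/
theorem exists_eq_smul_pow_of_fixed [IsGalois K Ω] {d : ℕ} [NeZero d] {η : K}
    (hη : IsPrimitiveRoot η d) {β y : Ω} (hβ : β ≠ 0) (hy : y ≠ 0)
    (hβd : β ^ d ∈ (⊥ : IntermediateField K Ω)) (hyd : y ^ d ∈ (⊥ : IntermediateField K Ω))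
    {τ : Gal(Ω/K)} (hτ : τ β = η • β) (hfix : ∀ ρ : Gal(Ω/K), ρ β = β → ρ y = y) :
    ∃ (u : Kˣ) (e : ℕ), y = u • β ^ e := by
  rw [InfiniteGalois.mem_bot_iff_fixed] at hβd hyd
  obtain ⟨e, he⟩ := exists_apply_eq_pow_smul hη hy (hyd τ)
  have hquot : y / β ^ e ∈ (⊥ : IntermediateField K Ω) := by
    refine (InfiniteGalois.mem_bot_iff_fixed _).mpr fun σ => ?_
    obtain ⟨i, hi⟩ := exists_apply_eq_pow_smul hη hβ (hβd σ)
    have hβσ : ((τ ^ i)⁻¹ * σ) β = β := by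
      rw [AlgEquiv.mul_apply, hi, ← pow_apply_of_apply_eq_smul hτ, ← AlgEquiv.mul_apply,
        inv_mul_cancel, AlgEquiv.one_apply]
    have hyσ : σ y = (η ^ i) ^ e • y := by
      rw [pow_right_comm, ← pow_apply_of_apply_eq_smul he]
      nth_rewrite 2 [← hfix _ hβσ]
      rw [← AlgEquiv.mul_apply, mul_inv_cancel_left]
    have hη₀ : η ^ i ≠ 0 := pow_ne_zero i (hη.ne_zero (NeZero.ne d))
    rw [map_div₀, map_pow, hi, hyσ, _root_.smul_pow, Algebra.smul_def, Algebra.smul_def,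
      mul_div_mul_left _ _ (by simpa using pow_ne_zero e hη₀)]
  obtain ⟨u, hu⟩ := IntermediateField.mem_bot.mp hquot
  have hu₀ : u ≠ 0 := by
    rintro rfl
    rw [map_zero] at hu
    exact div_ne_zero hy (pow_ne_zero e hβ) hu.symm
  refine ⟨Units.mk0 u hu₀, e, ?_⟩
  rw [Units.smul_mk0, Algebra.smul_def, hu, div_mul_cancel₀ _ (pow_ne_zero e hβ)]

end Kummer

section Descent

theorem prod_range_mul_of_periodic {M : Type*} [CommMonoid M] {f : ℕ → M} {e : ℕ}
    (hf : Function.Periodic f e) (d : ℕ) :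
    ∏ j ∈ Finset.range (e * d), f j = (∏ j ∈ Finset.range e, f j) ^ d := by
  induction d with
  | zero => simp
  | succ d ih =>
    have hshift (j : ℕ) : f (e * d + j) = f j := by
      rw [add_comm, mul_comm]
      exact hf.nat_mul d j
    simp only [Nat.mul_succ, Finset.prod_range_add, ih, hshift, pow_succ]

theorem div_gcd_mul_eq_mul_div_gcd (d q : ℕ) : q / d.gcd q * d = q * (d / d.gcd q) := by
  rw [← Nat.mul_div_assoc _ (Nat.gcd_dvd_left d q),
    Nat.div_mul_right_comm (Nat.gcd_dvd_right d q)]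

theorem mk_mem_zpowers_mk_of_eq_pow_mul_pow {G : Type*} [CommGroup G] {d i : ℕ} {x g u : G}
    (h : x = g ^ i * u ^ d) :
    (x : G ⧸ (powMonoidHom d : G →* G).range) ∈
      Subgroup.zpowers (g : G ⧸ (powMonoidHom d : G →* G).range) := by
  refine Subgroup.mem_zpowers_iff.mpr ⟨i, ?_⟩
  rw [zpow_natCast, ← QuotientGroup.mk_pow, QuotientGroup.eq, h, inv_mul_cancel_left]
  exact ⟨u, rfl⟩

variable {K Ω : Type*} [Field K] [Field Ω] [Algebra K Ω]

/-- The roots of unity by which `ρ` multiplies the `w j` are periodic in `j` with period `e`, so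
their product over `e * d` indices is a `d`-th power. -/
theorem prod_pow_fixed_of_comm {d e q : ℕ} [NeZero q] {ω : K} (hω : IsPrimitiveRoot ω q)
    {w : ℕ → Ω} (hw : ∀ j, w j ≠ 0) {ρ τ : Gal(Ω/K)} (hρ : ∀ j, ρ (w j ^ q) = w j ^ q)
    (hτ : ∀ j, τ (w j ^ q) = w (j + e) ^ q) (hcomm : ∀ j, ρ (τ (w j)) = τ (ρ (w j))) :
    ρ ((∏ j ∈ Finset.range (e * d), w j) ^ (q / d.gcd q)) =
      (∏ j ∈ Finset.range (e * d), w j) ^ (q / d.gcd q) := by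
  choose i hi using fun j => exists_apply_eq_pow_smul hω (hw j) (hρ j)
  have hper : Function.Periodic (fun j => ω ^ i j) e := fun j => by
    obtain ⟨l, hl⟩ : ∃ l : ℕ, τ (w j) = ω ^ l • w (j + e) :=
      exists_eq_pow_smul_of_pow_eq hω (hw _) (by rw [← map_pow, hτ])
    have h := hcomm j
    rw [hi, hl, map_smul, map_smul, hi, hl, smul_comm] at h
    exact smul_left_injective K (smul_ne_zero (pow_ne_zero l (hω.ne_zero (NeZero.ne q))) (hw _)) h
  have hprod : ρ (∏ j ∈ Finset.range (e * d), w j) =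
      (∏ j ∈ Finset.range e, ω ^ i j) ^ d • ∏ j ∈ Finset.range (e * d), w j := by
    rw [map_prod, Finset.prod_congr rfl fun j _ => hi j, Finset.prod_smul,
      prod_range_mul_of_periodic hper]
  have hone : ((∏ j ∈ Finset.range e, ω ^ i j) ^ d) ^ (q / d.gcd q) = 1 := by
    rw [pow_right_comm, ← pow_mul, div_gcd_mul_eq_mul_div_gcd, pow_mul,
      Finset.prod_pow_eq_pow_sum, pow_right_comm ω _ q, hω.pow_eq_one, one_pow, one_pow]
  rw [map_pow, hprod, _root_.smul_pow, hone, one_smul]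

theorem exists_pow_eq_pow_mul_pow_of_comm [IsGalois K Ω] {d e q : ℕ} [NeZero (e * d)] [NeZero q]
    {ζ ω : K} (hζ : IsPrimitiveRoot ζ (e * d)) (hω : IsPrimitiveRoot ω q) {β : Ω} {γ c : Kˣ}
    (hdeg : (minpoly K β).natDegree = d) (hβ : β ^ d = algebraMap K Ω γ) {δ : Ω → Ω}
    (hδ : ∀ (σ : Gal(Ω/K)) x, σ (δ x) = δ (σ x))
    (hc : ∏ j ∈ Finset.range (e * d), δ (ζ ^ j • β) = algebraMap K Ω c)
    (hroot : ∀ j : ℕ, ∃ w, w ^ q = δ (ζ ^ j • β) ∧ ∀ σ τ : Gal(Ω/K), σ (τ w) = τ (σ w)) :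
    ∃ (u : Kˣ) (i : ℕ), c ^ (d / d.gcd q) = γ ^ i * u ^ d := by
  have : NeZero d := ⟨right_ne_zero_of_mul (NeZero.ne (e * d))⟩
  choose w hw hcomm using hroot
  have hw₀ (j : ℕ) : w j ≠ 0 := by
    have hprod : ∏ j ∈ Finset.range (e * d), δ (ζ ^ j • β) ≠ 0 := hc ▸ by simp
    refine ne_zero_pow (NeZero.ne q) ?_
    rw [hw, ← pow_mod_orderOf, ← hζ.eq_orderOf]
    exact Finset.prod_ne_zero_iff.mp hprod _
      (Finset.mem_range.mpr (Nat.mod_lt j (NeZero.pos (e * d))))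
  have hη : IsPrimitiveRoot (ζ ^ e) d := hζ.pow (NeZero.pos _) rfl
  have hβd : β ^ d ∈ (⊥ : IntermediateField K Ω) := IntermediateField.mem_bot.mpr ⟨γ, hβ.symm⟩
  obtain ⟨τ, hτ⟩ : ∃ τ : Gal(Ω/K), τ β = ζ ^ e • β :=
    exists_algEquiv_apply_eq_smul (by rwa [hdeg]) (by rw [hdeg, hη.pow_eq_one])
  set y := (∏ j ∈ Finset.range (e * d), w j) ^ (q / d.gcd q)
  have hyd : y ^ d = algebraMap K Ω (c ^ (d / d.gcd q) : Kˣ) := by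
    rw [← pow_mul, div_gcd_mul_eq_mul_div_gcd, pow_mul, ← Finset.prod_pow,
      Finset.prod_congr rfl fun j _ => hw j, hc, Units.val_pow_eq_pow_val, map_pow]
  have hy (ρ : Gal(Ω/K)) (hρ : ρ β = β) : ρ y = y :=
    prod_pow_fixed_of_comm hω hw₀ (fun j => by rw [hw, hδ, map_smul, hρ])
      (fun j => by rw [hw, hw, hδ, map_smul, hτ, smul_smul, ← pow_add]) fun j => hcomm j ρ τ
  obtain ⟨u, i, hu⟩ := exists_eq_smul_pow_of_fixed hη (ne_zero_of_pow_eq_algebraMap hβ)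
    (ne_zero_of_pow_eq_algebraMap hyd) hβd (IntermediateField.mem_bot.mpr ⟨_, hyd.symm⟩) hτ hy
  refine ⟨u, i, Units.ext ((algebraMap K Ω).injective ?_)⟩
  rw [← hyd, hu, _root_.smul_pow, pow_right_comm, hβ, Units.smul_def, Units.val_pow_eq_pow_val,
    Algebra.smul_def, mul_comm]
  simp

end Descent

section Arboreal

variable {K : Type*} [Field K] {n : ℕ → ℕ} {a b : ℕ → K} {α : K}

theorem mem_arborealField (hn : ∀ k, 1 ≤ k → n k ≠ 0) (ha : ∀ k, 1 ≤ k → a k ≠ 0) {m : ℕ}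
    {z : SeparableClosure K} (hz : aeval z (iter n a b m) = algebraMap K _ α) :
    z ∈ arborealField n a b α := by
  refine IntermediateField.subset_adjoin _ _ (Set.mem_iUnion.mpr ⟨m, ?_⟩)
  exact mem_rootSet.mpr ⟨iter_sub_C_ne_zero hn ha α m, by simp [hz]⟩

theorem normal_arborealField (n : ℕ → ℕ) (a b : ℕ → K) (α : K) :
    Normal K (arborealField n a b α) := by
  rw [IntermediateField.normal_iff_forall_map_le]
  intro σ
  rw [arborealField, IntermediateField.adjoin_map, Set.image_iUnion]
  refine IntermediateField.adjoin.mono _ _ _ (Set.iUnion_mono fun m => ?_)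
  rintro _ ⟨z, hz, rfl⟩
  rw [mem_rootSet] at hz ⊢
  exact ⟨hz.1, by rw [aeval_algHom_apply, hz.2, map_zero]⟩

theorem comm_of_mem_arborealField (hab : ∀ σ τ : arborealGroup n a b α, σ * τ = τ * σ)
    (σ τ : Gal(SeparableClosure K/K)) {x : SeparableClosure K} (hx : x ∈ arborealField n a b α) :
    σ (τ x) = τ (σ x) := by
  have := normal_arborealField n a b α
  have h := congrArg (fun φ => ((φ ⟨x, hx⟩ : arborealField n a b α) : SeparableClosure K))
    (hab (σ.restrictNormal _) (τ.restrictNormal _))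
  simpa [AlgEquiv.restrictNormal_apply] using h

theorem pow_eq_algebraMap_cTilde_one_iff (hn : n 1 ≠ 0) (ha : a 1 ≠ 0) {z : SeparableClosure K} :
    z ^ n 1 = algebraMap K _ (cTilde n a b α 1) ↔ aeval z (poly n a b 1) = algebraMap K _ α := by
  rw [map_cTilde, pow_eq_cTilde_one_iff hn (by simpa using ha), ← eval_map_algebraMap, ← iter_one,
    ← iter_one, map_iter]

theorem firstField_eq_adjoin [NeZero (n 1)] (ha : a 1 ≠ 0) {ζ : K} (hζ : IsPrimitiveRoot ζ (n 1))
    {β : SeparableClosure K} (hβ : β ≠ 0) (hβc : β ^ n 1 = algebraMap K _ (cTilde n a b α 1)) :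
    firstField n a b α = IntermediateField.adjoin K {β} := by
  have hpoly : poly n a b 1 - C α ≠ 0 := by
    refine ne_zero_of_natDegree_gt (n := 0) ?_
    rw [natDegree_sub_C, poly, natDegree_add_C, natDegree_C_mul_X_pow _ _ ha]
    exact NeZero.pos _
  have hroot (z : SeparableClosure K) :
      z ∈ (poly n a b 1 - C α).rootSet (SeparableClosure K) ↔ z ^ n 1 = β ^ n 1 := by
    rw [hβc, pow_eq_algebraMap_cTilde_one_iff (NeZero.ne _) ha, mem_rootSet, map_sub, aeval_C,
      sub_eq_zero, and_iff_right hpoly]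
  refine le_antisymm (IntermediateField.adjoin_le_iff.mpr fun z hz => ?_)
    (IntermediateField.adjoin_simple_le_iff.mpr
      (IntermediateField.subset_adjoin _ _ ((hroot β).mpr rfl)))
  obtain ⟨i, rfl⟩ := exists_eq_pow_smul_of_pow_eq hζ hβ ((hroot z).mp hz)
  exact IntermediateField.smul_mem _ (IntermediateField.mem_adjoin_simple_self K β)

theorem finrank_firstField [NeZero (n 1)] (ha : a 1 ≠ 0) {ζ : K} (hζ : IsPrimitiveRoot ζ (n 1))
    {β : SeparableClosure K} (hβ : β ≠ 0) (hβc : β ^ n 1 = algebraMap K _ (cTilde n a b α 1)) :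
    Module.finrank K (firstField n a b α) = (minpoly K β).natDegree := by
  rw [firstField_eq_adjoin ha hζ hβ hβc]
  exact IntermediateField.adjoin.finrank (Algebra.IsIntegral.isIntegral β)

theorem finrank_firstField_dvd_and_exists_pow_eq [NeZero (n 1)] (ha : ∀ k, 1 ≤ k → a k ≠ 0)
    (hc : ∀ m, 1 ≤ m → adjOrbit n a b α m ≠ 0) {ζ : K} (hζ : IsPrimitiveRoot ζ (n 1)) :
    Module.finrank K (firstField n a b α) ∣ n 1 ∧
      ∃ γ : Kˣ, γ ^ (n 1 / Module.finrank K (firstField n a b α)) = cTildeUnit ha hc 1 le_rfl := by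
  obtain ⟨β, hβ⟩ : ∃ β : SeparableClosure K,
      β ^ n 1 = algebraMap K _ (cTildeUnit ha hc 1 le_rfl : K) :=
    exists_pow_eq_of_isPrimitiveRoot hζ _
  rw [finrank_firstField (ha 1 le_rfl) hζ (ne_zero_of_pow_eq_algebraMap hβ) hβ]
  exact exists_units_pow_div_natDegree_minpoly_eq hζ hβ

theorem exists_pow_eq_cTilde_shift (hn : ∀ k, 1 ≤ k → n k ≠ 0)
    (hζ : ∀ k, 1 ≤ k → ∃ ζ : K, IsPrimitiveRoot ζ (n k)) (ha : ∀ k, 1 ≤ k → a k ≠ 0)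
    {x : SeparableClosure K} (hx : aeval x (poly n a b 1) = algebraMap K _ α) (m : ℕ) :
    ∃ w ∈ arborealField n a b α, w ^ n (m + 2) =
      cTilde (shift n) (shift (algebraMap K _ ∘ a)) (shift (algebraMap K _ ∘ b)) x (m + 1) := by
  have hnK (k : ℕ) (hk : 1 ≤ k) : (n k : SeparableClosure K) ≠ 0 := by
    have : NeZero (n k) := ⟨hn k hk⟩
    obtain ⟨ζ, hζ⟩ := hζ k hk
    have := (hζ.map_of_injective (algebraMap K (SeparableClosure K)).injective).neZero'
    exact NeZero.ne _
  refine exists_pow_eq_cTilde (n := shift n) (fun k _ => hnK _ (by omega))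
    (fun k _ => by simpa [shift] using ha (k + 1) (by omega))
    (S := (arborealField n a b α).toSubalgebra.toSubmonoid) fun z hz => ?_
  refine mem_arborealField (m := m + 2) hn ha ?_
  rw [← hx, ← eval_map_algebraMap, map_iter, iter_succ_eq_poly_comp, eval_comp, hz, ← iter_one,
    ← map_iter, eval_map_algebraMap, iter_one]

theorem algebraMap_cTilde_succ_eq_prod (hn : n 1 ≠ 0) (ha : a 1 ≠ 0) {ζ : K}
    (hζ : IsPrimitiveRoot ζ (n 1)) {β : SeparableClosure K}
    (hβ : aeval β (poly n a b 1) = algebraMap K _ α) (m : ℕ) :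
    algebraMap K (SeparableClosure K) (cTilde n a b α (m + 2)) =
      ∏ j ∈ Finset.range (n 1), cTilde (shift n) (shift (algebraMap K _ ∘ a))
        (shift (algebraMap K _ ∘ b)) (ζ ^ j • β) (m + 1) := by
  rw [map_cTilde, ← hβ, ← iter_one, ← eval_map_algebraMap, map_iter, iter_one,
    cTilde_succ_eq_prod hn (by simpa using ha)
      (hζ.map_of_injective (algebraMap K (SeparableClosure K)).injective)]
  simp only [Algebra.smul_def, map_pow]

theorem exists_cTildeUnit_pow_eq (hn : ∀ k, 1 ≤ k → n k ≠ 0)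
    (hζ : ∀ k, 1 ≤ k → ∃ ζ : K, IsPrimitiveRoot ζ (n k)) (ha : ∀ k, 1 ≤ k → a k ≠ 0)
    (hc : ∀ m, 1 ≤ m → adjOrbit n a b α m ≠ 0)
    (hab : ∀ σ τ : arborealGroup n a b α, σ * τ = τ * σ) {d : ℕ}
    (hd : d = Module.finrank K (firstField n a b α)) {γ : Kˣ}
    (hγ : γ ^ (n 1 / d) = cTildeUnit ha hc 1 le_rfl) {k : ℕ} (hk : 2 ≤ k) :
    ∃ (u : Kˣ) (i : ℕ),
      cTildeUnit ha hc k (one_le_two.trans hk) ^ (d / d.gcd (n k)) = γ ^ i * u ^ d := by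
  have ha₁ := ha 1 le_rfl
  have hn₁ := hn 1 le_rfl
  have : NeZero (n 1) := ⟨hn₁⟩
  have : NeZero (n k) := ⟨hn k (by omega)⟩
  obtain ⟨ζ, hζ₁⟩ := hζ 1 le_rfl
  obtain ⟨ω, hω⟩ := hζ k (by omega)
  obtain ⟨m, rfl⟩ := Nat.exists_eq_add_of_le' hk
  have hdvd : d ∣ n 1 := hd ▸ (finrank_firstField_dvd_and_exists_pow_eq ha hc hζ₁).1
  obtain ⟨e, he⟩ := exists_eq_mul_left_of_dvd hdvd
  have : NeZero (e * d) := ⟨he ▸ hn₁⟩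
  have : NeZero d := ⟨right_ne_zero_of_mul (NeZero.ne (e * d))⟩
  obtain ⟨β, hβ⟩ : ∃ β : SeparableClosure K, β ^ d = algebraMap K _ (γ : K) :=
    exists_pow_eq_of_isPrimitiveRoot (hζ₁.pow (NeZero.pos _) he) _
  have hβc : β ^ n 1 = algebraMap K _ (cTildeUnit ha hc 1 le_rfl : K) := by
    rw [← hγ, Units.val_pow_eq_pow_val, map_pow, ← hβ, ← pow_mul, Nat.mul_div_cancel' hdvd]
  have hdeg : (minpoly K β).natDegree = d :=
    (hd.trans (finrank_firstField ha₁ hζ₁ (ne_zero_of_pow_eq_algebraMap hβ) hβc)).symm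
  have hnode (j : ℕ) : aeval (ζ ^ j • β) (poly n a b 1) = algebraMap K _ α := by
    rw [← pow_eq_algebraMap_cTilde_one_iff hn₁ ha₁, _root_.smul_pow, pow_right_comm,
      hζ₁.pow_eq_one, one_pow, one_smul]
    exact hβc
  refine exists_pow_eq_pow_mul_pow_of_comm (he ▸ hζ₁) hω hdeg hβ
    (δ := fun x => cTilde (shift n) (shift (algebraMap K _ ∘ a)) (shift (algebraMap K _ ∘ b)) x
      (m + 1)) (fun σ x => ?_) ?_ fun j => ?_
  · refine (map_cTilde (σ : SeparableClosure K →+* SeparableClosure K) _ _ _ x (m + 1)).trans ?_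
    congr 1 <;> ext i <;> simp [shift]
  · rw [← he]
    exact (algebraMap_cTilde_succ_eq_prod hn₁ ha₁ hζ₁ (by simpa using hnode 0) m).symm
  · obtain ⟨w, hwmem, hw⟩ := exists_pow_eq_cTilde_shift hn hζ ha (hnode j) m
    exact ⟨w, hw, fun σ τ => comm_of_mem_arborealField hab σ τ hwmem⟩

end Arboreal

end ArborealSeq

theorem mainTheorem6 {K : Type*} [Field K] (n : ℕ → ℕ) (hn : ∀ k, 1 ≤ k → 2 ≤ n k)
    (hζ : ∀ k, 1 ≤ k → ∃ ζ : K, IsPrimitiveRoot ζ (n k))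
    (a b : ℕ → K) (ha : ∀ k, 1 ≤ k → a k ≠ 0) (α : K)
    (hc : ∀ m, 1 ≤ m → ArborealSeq.adjOrbit n a b α m ≠ 0)
    (d₁ : ℕ) (hd₁ : d₁ = Module.finrank K (ArborealSeq.firstField n a b α))
    (hab : ∀ σ τ : ArborealSeq.arborealGroup n a b α, σ * τ = τ * σ) :
    d₁ ∣ n 1 ∧
    (∃ γ₁ : Kˣ, γ₁ ^ (n 1 / d₁) = ArborealSeq.cTildeUnit ha hc 1 le_rfl) ∧
    ∀ γ₁ : Kˣ, γ₁ ^ (n 1 / d₁) = ArborealSeq.cTildeUnit ha hc 1 le_rfl →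
      Subgroup.closure {x : Kˣ ⧸ ArborealSeq.powSubgroup K d₁ |
          ∃ (k : ℕ) (hk : 2 ≤ k),
            x = QuotientGroup.mk
              (ArborealSeq.cTildeUnit ha hc k (one_le_two.trans hk) ^ (d₁ / Nat.gcd d₁ (n k)))} ≤
        Subgroup.zpowers (QuotientGroup.mk γ₁ : Kˣ ⧸ ArborealSeq.powSubgroup K d₁) := by
  have hn₀ (k : ℕ) (hk : 1 ≤ k) : n k ≠ 0 := (two_pos.trans_le (hn k hk)).ne'
  have : NeZero (n 1) := ⟨hn₀ 1 le_rfl⟩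
  obtain ⟨ζ, hζ₁⟩ := hζ 1 le_rfl
  obtain ⟨hdvd, hγ⟩ := ArborealSeq.finrank_firstField_dvd_and_exists_pow_eq ha hc hζ₁
  rw [← hd₁] at hdvd hγ
  refine ⟨hdvd, hγ, fun γ₁ hγ₁ => (Subgroup.closure_le _).mpr ?_⟩
  rintro _ ⟨k, hk, rfl⟩
  obtain ⟨u, i, hui⟩ := ArborealSeq.exists_cTildeUnit_pow_eq hn₀ hζ ha hc hab hd₁ hγ₁ hk
  exact ArborealSeq.mk_mem_zpowers_mk_of_eq_pow_mul_pow hui
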